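/- Let $m>1$. Let $d\in C^2([0,\infty))$ with $d(0)=0$ and $d'(s)>0$, $d''(s)\ge 0$ for $s>0$. Let $\kappa>0$ and let $b\in C^1([0,\infty);[0,\infty))$ have exactly one positive local extremum point, which is a global maximum point, and satisfy $b(0)=0$, $b(\kappa)=d(\kappa)$, $b'(0)>d'(0)$, $b'(\kappa)<d'(\kappa)$ and $d(s)<b(s)\le b'(0)s$ for $s\in(0,\kappa)$. For $D>0$, $r\ge 0$ and $c\in\mathbb R$, a semi-wavefront of speed $c$ for $u_t=D(u^m)_{xx}-d(u)+b(u(t-r,x))$ is a function $0\le\phi\in W^{1,1}_{\mathrm{loc}}(\mathbb R)\cap L^\infty(\mathbb R)$ (identified with its continuous representative) with $\phi^m\in W^{1,1}_{\mathrm{loc}}(\mathbb R)$ such that (i) $c\phi'(t)=D(\phi^m)''(t)-d(\phi(t))+b(\phi(t-cr))$ on $\mathbb R$ in the sense of distributions; (ii) $\phi(-\infty)=0$ and $0<\liminf_{t\to+\infty}\phi(t)\le\limsup_{t\to+\infty}\phi(t)<+\infty$; (iii) there is a maximal interval $(-\infty,t_0)$, $t_0\in(-\infty,+\infty]$, on which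 $\phi$ is monotonically increasing (in the non-strict sense), and $\phi(t_0)>\kappa$ if $t_0<+\infty$. (A wavefront is a semi-wavefront with $\phi(+\infty)=\kappa$. A semi-wavefront is sharp if for some $t_*\in\mathbb R$ it vanishes on $(-\infty,t_*]$ and is positive on $(t_*,\infty)$, and smooth if it is positive everywhere.) Theorem (non-existence of waves). There are a function $\dot c(\cdot)=\dot c(m,\cdot,b,d):[0,\infty)\to(0,\infty)$ and a constant $\mu_0=\mu_0(m,b,d)>0$ such that, for every $D>0$ and $r\ge 0$, there is no semi-wavefront (in particular no wavefront, and none of sharp or smooth type) of speed $c<\sqrt{D}\,\dot c(m,r,b,d)$. Moreover, $$\dot c(m,r,b,d)=\frac{\mu_0(m,b,d)+o(1)}{r},\qquad r\to+\infty.$$ -/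

import Mathlib

open Filter Topology MeasureTheory Set
open scoped ContDiff

namespace DelayWave

/-- Smooth compactly supported test functions on the real line. -/
def IsTestFunction (ψ : ℝ → ℝ) : Prop :=
  ContDiff ℝ ∞ ψ ∧ HasCompactSupport ψ

/-- `g` is the weak (distributional) derivative of `f` on the real line. -/
def HasWeakDeriv (f g : ℝ → ℝ) : Prop :=
  ∀ ψ : ℝ → ℝ, IsTestFunction ψ → ∫ t, f t * deriv ψ t = -∫ t, g t * ψ t

/-- The local Sobolev space `W^{1,1}_loc(ℝ)`. -/
def MemW11Loc (f : ℝ → ℝ) : Prop :=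
  LocallyIntegrable f volume ∧ ∃ g : ℝ → ℝ, LocallyIntegrable g volume ∧ HasWeakDeriv f g

/-- Standing assumptions on the death rate: `d ∈ C²([0,∞))`, `d(0) = 0`, and `d' > 0`, `d'' ≥ 0`
on `(0,∞)`. Only the values of `d` on `[0,∞)` matter. -/
structure IsDeathRate (d : ℝ → ℝ) : Prop where
  contDiffOn : ContDiffOn ℝ 2 d (Ici 0)
  zero : d 0 = 0
  deriv_pos : ∀ s, 0 < s → 0 < deriv d s
  deriv2_nonneg : ∀ s, 0 < s → 0 ≤ deriv (deriv d) s

/-- Standing (unimodality) assumptions on the birth rate `b`, with positive equilibrium `κ`: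
`b ∈ C¹([0,∞); [0,∞))` has exactly one positive local extremum point, which is a global maximum
point, and `b` is related to the death rate `d` as displayed. The derivatives at `0` are one-sided.
Only the values of `b` on `[0,∞)` matter. -/
structure IsUnimodalBirthRate (b d : ℝ → ℝ) (κ : ℝ) : Prop where
  contDiffOn : ContDiffOn ℝ 1 b (Ici 0)
  nonneg : ∀ s, 0 ≤ s → 0 ≤ b s
  unimodal : ∃ sM : ℝ, 0 < sM ∧ (∀ s, 0 < s → (IsLocalExtr b s ↔ s = sM)) ∧
    IsMaxOn b (Ici 0) sM
  zero : b 0 = 0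
  equilibrium_pos : 0 < κ
  equilibrium : b κ = d κ
  deriv_zero : derivWithin d (Ici 0) 0 < derivWithin b (Ici 0) 0
  deriv_equilibrium : deriv b κ < deriv d κ
  lower : ∀ s, 0 < s → s < κ → d s < b s
  upper : ∀ s, 0 < s → s < κ → b s ≤ derivWithin b (Ici 0) 0 * s

/-- The profile equation `c φ'(t) = D (φ^m)''(t) - d(φ(t)) + b(φ(t - c r))` on the whole line,
in the sense of distributions. -/
def SatisfiesProfileEq (m D r c : ℝ) (b d φ : ℝ → ℝ) : Prop :=
  ∀ ψ : ℝ → ℝ, IsTestFunction ψ →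
    -(c * ∫ t, φ t * deriv ψ t) =
      D * (∫ t, φ t ^ m * deriv (deriv ψ) t) - (∫ t, d (φ t) * ψ t)
        + ∫ t, b (φ (t - c * r)) * ψ t

/-- The leading edge of `φ` near `-∞` is monotonically increasing: there is a maximal interval
`(-∞, t₀)`, `t₀ ∈ (-∞, +∞]`, on which `φ` is increasing, and `φ(t₀) > κ` in case `t₀ < +∞`.
(The first alternative is the case `t₀ = +∞`.) -/
def HasIncreasingLeadingEdge (κ : ℝ) (φ : ℝ → ℝ) : Prop :=
  Monotone φ ∨
    ∃ t₀ : ℝ, MonotoneOn φ (Iio t₀) ∧ (∀ t₁, t₀ < t₁ → ¬ MonotoneOn φ (Iio t₁)) ∧ κ < φ t₀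

/-- `φ` is the profile of a semi-wavefront of speed `c` for
`u_t = D (u^m)_{xx} - d(u) + b(u(t - r, x))`. A function in `W^{1,1}_loc(ℝ)` is identified with
its continuous representative; with `bounded`, this makes `φ` an element of `L^∞(ℝ)` and makes
the upper limit of `φ` at `+∞` finite. Wavefronts (those with `φ(+∞) = κ`), sharp waves (those
vanishing exactly on some `(-∞, t_*]`) and smooth waves (those positive everywhere) are special
semi-wavefronts. -/
structure IsSemiWavefront (m D r c : ℝ) (b d : ℝ → ℝ) (κ : ℝ) (φ : ℝ → ℝ) : Prop where
  continuous : Continuous φ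
  nonneg : ∀ t, 0 ≤ φ t
  bounded : ∃ C, ∀ t, φ t ≤ C
  sobolev : MemW11Loc φ
  sobolev_pow : MemW11Loc (fun t => φ t ^ m)
  profileEq : SatisfiesProfileEq m D r c b d φ
  tendsto_atBot : Tendsto φ atBot (𝓝 0)
  liminf_pos : 0 < liminf φ atTop
  leadingEdge : HasIncreasingLeadingEdge κ φ

end DelayWave

namespace DelayWave

/-! Integrating the profile equation from `-∞` gives, for the flux `q = D (φ^m)'`, the identity `q =
c φ + ∫_{t-cr}^t b(φ) - ∫_{-∞}^t (b(φ) - d(φ))`. While `φ < κ` the last integrand is nonnegative, so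
it can only brake the wave. Take levels `0 < x < y < κ`, with `b - d ≥ β > 0` on `[x, y]`, and let
`E` bound the first two terms. During the climb from `x` to `y` the slope of `D φ^m` is at most `E -
β (t - s)`, so the total rise is at most `E² / (2β)` (`mul_rpow_sub_le`). But the rise is `D (y^m -
x^m)`, while `E` is small when `c (r + 1)` is small relative to `√D`: slow waves cannot climb. The
flux comes from `exists_flux`, its bound from `flux_le`; `exists_le` shows that level `y` is
reached. -/

theorem IsTestFunction.deriv {ψ : ℝ → ℝ} (h : IsTestFunction ψ) : IsTestFunction (deriv ψ) :=
  ⟨(contDiff_infty_iff_deriv.1 h.1).2, h.2.deriv⟩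

/-! ### From distributions to a classical flux -/

/-- The second-order lemma of du Bois-Reymond: a continuous function whose second distributional
derivative vanishes is affine. -/
theorem eq_affine_of_integral_mul_deriv_deriv_eq_zero {f : ℝ → ℝ} (hf : Continuous f)
    (h : ∀ ψ, IsTestFunction ψ → ∫ t, f t * deriv (deriv ψ) t = 0) (x : ℝ) :
    f x = f 0 + x * (f 1 - f 0) := by
  let L := ContinuousLinearMap.lsmul ℝ ℝ (E := ℝ)
  let ρ : ℕ → ContDiffBump (0 : ℝ) := fun n =>
    ⟨1 / ((n : ℝ) + 1) / 2, 1 / ((n : ℝ) + 1), by positivity, half_lt_self (by positivity)⟩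
  have hρ : Tendsto (fun n => (ρ n).rOut) atTop (𝓝 0) := tendsto_one_div_add_atTop_nhds_zero_nat
  have hlim := fun y => ContDiffBump.convolution_tendsto_right_of_continuous (μ := volume) hρ hf y
  have haff : ∀ n y, convolution ((ρ n).normed volume) f L volume y =
      convolution ((ρ n).normed volume) f L volume 0 +
        y * (convolution ((ρ n).normed volume) f L volume 1 -
          convolution ((ρ n).normed volume) f L volume 0) := by
    intro n
    have ht : IsTestFunction ((ρ n).normed volume) :=
      ⟨(ρ n).contDiff_normed, (ρ n).hasCompactSupport_normed⟩
    have h1 := fun y => ht.2.hasDerivAt_convolution_left L (μ := volume)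
      (ht.1.of_le (by simp)) hf.locallyIntegrable y
    have h2 := fun y => ht.deriv.2.hasDerivAt_convolution_left L (μ := volume)
      (ht.deriv.1.of_le (by simp)) hf.locallyIntegrable y
    -- The second derivative of the mollification at `y` is `f` tested against the second derivative
    -- of the reflected bump `t ↦ ρ (y - t)`; the two signs from the reflection cancel.
    have h3 : ∀ y, convolution (_root_.deriv (_root_.deriv ((ρ n).normed volume))) f L volume y
        = 0 := by
      intro y
      rw [convolution_lsmul_swap]
      have hψ : IsTestFunction (fun t => (ρ n).normed volume (y - t)) :=
        ⟨ht.1.comp (contDiff_const.sub contDiff_id),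
          ht.2.comp_homeomorph (Homeomorph.subLeft y)⟩
      refine Eq.trans ?_ (h _ hψ)
      congr 1
      ext t
      have e1 : _root_.deriv (fun t => (ρ n).normed volume (y - t)) =
          fun t => -_root_.deriv ((ρ n).normed volume) (y - t) := by
        ext s; rw [deriv_comp_const_sub]
      rw [e1, deriv.fun_neg, deriv_comp_const_sub]
      simp [mul_comm]
    set F := convolution ((ρ n).normed volume) f L volume
    set G := convolution (_root_.deriv ((ρ n).normed volume)) f L volume
    have hG : ∀ y, G y = G 0 := fun y => is_const_of_deriv_eq_zero
      (fun z => (h2 z).differentiableAt) (fun z => by rw [(h2 z).deriv, h3]) y 0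
    have hF : ∀ y, F y - y * G 0 = F 0 - 0 * G 0 := fun y => by
      have hd : ∀ z, HasDerivAt (fun y => F y - y * G 0) (G z - 1 * G 0) z := fun z =>
        (h1 z).sub ((hasDerivAt_id z).mul_const _)
      exact is_const_of_deriv_eq_zero (fun z => (hd z).differentiableAt)
        (fun z => by rw [(hd z).deriv, hG z]; ring) y 0
    intro y
    have := hF y
    have := hF 1
    have e : F 1 - F 0 = G 0 := by linarith
    rw [e]; linarith [hF y]
  refine tendsto_nhds_unique (hlim x) ?_
  refine Tendsto.congr (fun n => (haff n x).symm) ?_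
  exact (hlim 0).add (((hlim 1).sub (hlim 0)).const_mul x)

/-- Integration by parts against a test function. -/
theorem integral_mul_deriv_test {u u' ψ : ℝ → ℝ} (hu : ∀ x, HasDerivAt u (u' x) x)
    (hu' : Continuous u') (hψ : IsTestFunction ψ) :
    ∫ x, u x * deriv ψ x = -∫ x, u' x * ψ x := by
  have huc : Continuous u := continuous_iff_continuousAt.2 fun x => (hu x).continuousAt
  exact integral_mul_deriv_eq_deriv_mul_of_integrable (fun x _ => hu x)
    (fun x _ => (hψ.1.differentiable (by simp) x).hasDerivAt)
    ((huc.mul hψ.deriv.1.continuous).integrable_of_hasCompactSupport hψ.deriv.2.mul_left)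
    ((hu'.mul hψ.1.continuous).integrable_of_hasCompactSupport hψ.2.mul_left)
    ((huc.mul hψ.1.continuous).integrable_of_hasCompactSupport hψ.2.mul_left)

/-- A continuous distributional solution of `c φ' = (D w)'' + F` has a classical flux
`q = (D w)'` with `(q - c φ)' = -F`. -/
theorem exists_flux {φ w F : ℝ → ℝ} {c D : ℝ} (hφ : Continuous φ) (hw : Continuous w)
    (hF : Continuous F)
    (h : ∀ ψ, IsTestFunction ψ → -(c * ∫ t, φ t * deriv ψ t) =
      D * (∫ t, w t * deriv (deriv ψ) t) + ∫ t, F t * ψ t) :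
    ∃ q : ℝ → ℝ, (∀ t, HasDerivAt (fun t => D * w t) (q t) t) ∧
      ∀ s t, q t - c * φ t - (q s - c * φ s) = -∫ x in s..t, F x := by
  set P : ℝ → ℝ := fun t => ∫ x in (0 : ℝ)..t, F x with hPdef
  have hP : ∀ t, HasDerivAt P (F t) t := fun t => (hF.integral_hasStrictDerivAt 0 t).hasDerivAt
  have hPc : Continuous P := continuous_iff_continuousAt.2 fun x => (hP x).continuousAt
  have hR : Continuous fun t => P t - c * φ t := hPc.sub (hφ.const_mul c)
  set Q : ℝ → ℝ := fun t => ∫ x in (0 : ℝ)..t, (P x - c * φ x) with hQdef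
  have hQ : ∀ t, HasDerivAt Q (P t - c * φ t) t := fun t =>
    (hR.integral_hasStrictDerivAt 0 t).hasDerivAt
  have hQc : Continuous Q := continuous_iff_continuousAt.2 fun x => (hQ x).continuousAt
  -- `Q` is a double primitive of `F - c φ'`, so the equation says `(D w + Q)'' = 0`.
  have key : ∀ ψ, IsTestFunction ψ →
      ∫ t, (D * w t + Q t) * deriv (deriv ψ) t = 0 := by
    intro ψ hψ
    have hψ' := hψ.deriv
    have hψ'' := hψ'.deriv
    have hI : ∀ {g χ : ℝ → ℝ}, Continuous g → IsTestFunction χ → Integrable fun t => g t * χ t :=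
      fun hg hχ => (hg.mul hχ.1.continuous).integrable_of_hasCompactSupport hχ.2.mul_left
    have e1 := integral_mul_deriv_test hQ hR hψ'
    have e2 := integral_mul_deriv_test hP hF hψ
    have e3 : ∫ t, (P t - c * φ t) * deriv ψ t =
        (∫ t, P t * deriv ψ t) - c * ∫ t, φ t * deriv ψ t := by
      rw [← integral_const_mul, ← integral_sub (hI hPc hψ') ((hI hφ hψ').const_mul c)]
      congr 1; ext t; ring
    have e4 : ∫ t, (D * w t + Q t) * deriv (deriv ψ) t =
        D * (∫ t, w t * deriv (deriv ψ) t) + ∫ t, Q t * deriv (deriv ψ) t := by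
      rw [← integral_const_mul, ← integral_add ((hI hw hψ'').const_mul D) (hI hQc hψ'')]
      congr 1; ext t; ring
    have := h ψ hψ
    linarith
  have haff := eq_affine_of_integral_mul_deriv_deriv_eq_zero ((hw.const_mul D).add hQc) key
  set a := D * w 0 + Q 0
  set k := D * w 1 + Q 1 - a
  refine ⟨fun t => k - (P t - c * φ t), fun t => ?_, fun s t => ?_⟩
  · have e : (fun t => D * w t) = fun t => a + t * k - Q t := by
      ext t; have := haff t; simp only [Pi.add_apply] at this; linarith
    rw [e]
    simpa using (((hasDerivAt_id t).mul_const k).const_add a).fun_sub (hQ t)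
  · have := intervalIntegral.integral_interval_sub_left (hF.intervalIntegrable 0 t)
      (hF.intervalIntegrable (μ := volume) 0 s)
    simp only [hPdef]
    linarith

/-! ### One-variable estimates -/

/-- A function whose slope on `[T, t]` is at most `E - β (x - T)` lies below the parabola. -/
theorem le_parabola_of_deriv_le {f q : ℝ → ℝ} {E β T t : ℝ} (hTt : T ≤ t)
    (hf : ∀ x, HasDerivAt f (q x) x) (hq : ∀ x, T ≤ x → x ≤ t → q x ≤ E - β * (x - T)) :
    f t ≤ f T + E * (t - T) - β * (t - T) ^ 2 / 2 := by
  have hd : ∀ x, HasDerivAt (fun x => f x - (E * (x - T) - β * (x - T) ^ 2 / 2))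
      (q x - (E - β * (x - T))) x := fun x => by
    have h1 : HasDerivAt (fun x => x - T) 1 x := (hasDerivAt_id x).sub_const T
    refine ((hf x).fun_sub ((h1.const_mul E).fun_sub
      (((h1.fun_pow 2).const_mul β).div_const 2))).congr_deriv ?_
    norm_num
    ring
  have hanti : AntitoneOn (fun x => f x - (E * (x - T) - β * (x - T) ^ 2 / 2)) (Icc T t) := by
    refine antitoneOn_of_deriv_nonpos (convex_Icc T t)
      (fun x _ => (hd x).continuousAt.continuousWithinAt)
      (fun x _ => (hd x).differentiableAt.differentiableWithinAt) fun x hx => ?_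
    rw [interior_Icc] at hx
    rw [(hd x).deriv]
    linarith [hq x hx.1.le hx.2.le]
  have := hanti (left_mem_Icc.2 hTt) (right_mem_Icc.2 hTt) hTt
  simp only [sub_self] at this
  linarith

/-- The derivative of a function bounded below on a left half-line cannot stay above a positive
constant there. -/
theorem exists_le_deriv_lt {f q : ℝ → ℝ} (hf : ∀ x, HasDerivAt f (q x) x) (h0 : ∀ x, 0 ≤ f x)
    {ε : ℝ} (hε : 0 < ε) (s : ℝ) : ∃ x ≤ s, q x < ε := by
  by_contra! hcon
  have hmono : MonotoneOn (fun x => f x - ε * x) (Iic s) := by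
    have hd : ∀ x, HasDerivAt (fun x => f x - ε * x) (q x - ε * 1) x := fun x =>
      (hf x).fun_sub ((hasDerivAt_id x).const_mul ε)
    refine monotoneOn_of_deriv_nonneg (convex_Iic s)
      (fun x _ => (hd x).continuousAt.continuousWithinAt)
      (fun x _ => (hd x).differentiableAt.differentiableWithinAt) fun x hx => ?_
    rw [interior_Iic] at hx
    rw [(hd x).deriv]
    linarith [hcon x hx.le]
  -- At this point slope at least `ε` up to `s` would force `f ≤ -1`.
  have hx : s - (f s + 1) / ε ≤ s := sub_le_self _ (div_nonneg (by linarith [h0 s]) hε.le)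
  have := hmono (mem_Iic.2 hx) (mem_Iic.2 le_rfl) hx
  have e : ε * ((f s + 1) / ε) = f s + 1 := by field_simp
  simp only [mul_sub, e] at this
  linarith [h0 (s - (f s + 1) / ε)]

/-- The integral over a sliding window of fixed length of a function vanishing at `-∞` tends to
zero. -/
theorem tendsto_integral_window_atBot {g : ℝ → ℝ} (hg : Tendsto g atBot (𝓝 0)) (h : ℝ) :
    Tendsto (fun s => ∫ x in (s - h)..s, g x) atBot (𝓝 0) := by
  rw [Metric.tendsto_nhds]
  intro ε hε
  have hC : 0 < ε / (|h| + 1) := by positivity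
  obtain ⟨N, hN⟩ := eventually_atBot.1 ((Metric.tendsto_nhds.1 hg) _ hC)
  filter_upwards [eventually_le_atBot (N - |h|)] with s hs
  rw [dist_zero_right]
  have hb := intervalIntegral.norm_integral_le_of_norm_le_const (a := s - h) (b := s) (f := g)
    (C := ε / (|h| + 1)) fun x hx => by
      have h1 := (mem_uIoc.1 hx)
      have hxN : x ≤ N := by
        rcases h1 with h1 | h1 <;> linarith [h1.2, abs_nonneg h, neg_abs_le h]
      simpa using (hN x hxN).le
  refine hb.trans_lt ?_
  rw [sub_sub_cancel, div_mul_eq_mul_div, div_lt_iff₀ (by positivity)]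
  nlinarith [abs_nonneg h]

/-! ### Integrating the equation from `-∞` -/

section Flux

variable {φ w q β₁ δ₁ : ℝ → ℝ} {c D h : ℝ}

/-- As long as the net production `β₁ - δ₁` has been nonnegative, the flux is bounded by the
convection and delay terms minus the accumulated net production. -/
theorem flux_le (hw : ∀ t, HasDerivAt (fun t => D * w t) (q t) t) (hw0 : ∀ t, 0 ≤ D * w t)
    (hq : ∀ s t, q t - c * φ t - (q s - c * φ s) = -∫ x in s..t, (β₁ (x - h) - δ₁ x))
    (hφ : Tendsto φ atBot (𝓝 0)) (hβc : Continuous β₁) (hδc : Continuous δ₁)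
    (hβ : Tendsto β₁ atBot (𝓝 0)) {s t : ℝ}
    (hN : ∀ x ≤ s, δ₁ x ≤ β₁ x) :
    q t ≤ c * φ t + (∫ x in (t - h)..t, β₁ x) - ∫ x in s..t, (β₁ x - δ₁ x) := by
  refine le_of_forall_pos_le_add fun ε hε => ?_
  have hlim : Tendsto (fun s => c * φ s + ∫ x in (s - h)..s, β₁ x) atBot (𝓝 0) := by
    simpa using (hφ.const_mul c).add (tendsto_integral_window_atBot hβ h)
  obtain ⟨N, hNε⟩ := eventually_atBot.1 ((Metric.tendsto_nhds.1 hlim) (ε / 2) (half_pos hε))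
  -- The flux need not be known to vanish at `-∞`: an upper bound at one point `a` far to the left
  -- suffices, where the other boundary terms are small too.
  obtain ⟨a, ha, hqa⟩ := exists_le_deriv_lt hw hw0 (half_pos hε) (min N s)
  have hI : ∀ {g : ℝ → ℝ}, Continuous g → ∀ x y, IntervalIntegrable g volume x y :=
    fun hg x y => hg.intervalIntegrable x y
  -- Shifting the delayed integrand by `h` leaves two window integrals, one at each end.
  have hsplit : ∫ x in a..t, (β₁ (x - h) - δ₁ x) =
      (∫ x in a..t, (β₁ x - δ₁ x)) + (∫ x in (a - h)..a, β₁ x) - ∫ x in (t - h)..t, β₁ x := by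
    rw [intervalIntegral.integral_sub (hI (g := fun x => β₁ (x - h)) (by fun_prop) a t)
      (hI hδc a t), intervalIntegral.integral_sub (hI hβc a t) (hI hδc a t),
      intervalIntegral.integral_comp_sub_right]
    have := intervalIntegral.integral_interval_sub_interval_comm (hI hβc (a - h) (t - h))
      (hI hβc a t) (hI hβc (a - h) a)
    linarith
  have hadd := intervalIntegral.integral_add_adjacent_intervals
    (hI (hβc.sub hδc) a s) (hI (hβc.sub hδc) s t)
  have hpos : 0 ≤ ∫ x in a..s, (β₁ x - δ₁ x) :=
    intervalIntegral.integral_nonneg (ha.trans (min_le_right _ _))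
      fun x hx => sub_nonneg.2 (hN x hx.2)
  have h1 := (abs_lt.1 (by simpa [Real.dist_eq] using hNε a (ha.trans (min_le_left _ _)))).1
  have h2 := hq a t
  simp only [Pi.sub_apply] at hadd
  linarith

end Flux

/-! ### How far a semi-wavefront can climb -/

variable {b d φ : ℝ → ℝ} {κ m D r c : ℝ}

theorem exists_pos_le_netProduction (hd : IsDeathRate d) (hb : IsUnimodalBirthRate b d κ)
    {x y : ℝ} (hx : 0 < x) (hxy : x ≤ y) (hy : y < κ) :
    ∃ β > 0, ∀ s ∈ Icc x y, β ≤ b s - d s := by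
  have hsub : Icc x y ⊆ Ici (0 : ℝ) := fun s hs => hx.le.trans hs.1
  obtain ⟨s, hs, hmin⟩ := isCompact_Icc.exists_isMinOn (nonempty_Icc.2 hxy)
    ((hb.contDiffOn.continuousOn.mono hsub).sub (hd.contDiffOn.continuousOn.mono hsub))
  exact ⟨b s - d s, sub_pos.2 (hb.lower s (hx.trans_le hs.1) (hs.2.trans_lt hy)), hmin⟩

theorem IsUnimodalBirthRate.death_le (hd : IsDeathRate d) (hb : IsUnimodalBirthRate b d κ)
    {s : ℝ} (h0 : 0 ≤ s) (hs : s < κ) : d s ≤ b s := by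
  rcases h0.eq_or_lt with rfl | h
  · rw [hd.zero, hb.zero]
  · exact (hb.lower s h hs).le

namespace IsSemiWavefront

theorem continuous_birth (hb : IsUnimodalBirthRate b d κ)
    (hφ : IsSemiWavefront m D r c b d κ φ) : Continuous fun t => b (φ t) :=
  hb.contDiffOn.continuousOn.comp_continuous hφ.continuous hφ.nonneg

theorem continuous_death (hd : IsDeathRate d)
    (hφ : IsSemiWavefront m D r c b d κ φ) : Continuous fun t => d (φ t) :=
  hd.contDiffOn.continuousOn.comp_continuous hφ.continuous hφ.nonneg

theorem tendsto_birth_atBot (hb : IsUnimodalBirthRate b d κ)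
    (hφ : IsSemiWavefront m D r c b d κ φ) : Tendsto (fun t => b (φ t)) atBot (𝓝 0) := by
  have h := (hb.contDiffOn.continuousOn 0 self_mem_Ici).tendsto
  rw [hb.zero] at h
  exact h.comp (tendsto_nhdsWithin_iff.2
    ⟨hφ.tendsto_atBot, Eventually.of_forall hφ.nonneg⟩)

/-- The flux `D (φ^m)'` of a semi-wavefront exists classically, and is bounded by the convection
and delay terms minus the accumulated net production as long as `φ < κ`. -/
theorem exists_flux_le (hm : 1 < m) (hD : 0 < D) (hd : IsDeathRate d)
    (hb : IsUnimodalBirthRate b d κ) (hφ : IsSemiWavefront m D r c b d κ φ) :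
    ∃ q : ℝ → ℝ, (∀ t, HasDerivAt (fun t => D * φ t ^ m) (q t) t) ∧
      ∀ s t, (∀ x ≤ s, φ x < κ) → q t ≤ c * φ t + (∫ x in (t - c * r)..t, b (φ x)) -
        ∫ x in s..t, (b (φ x) - d (φ x)) := by
  have hbc := hφ.continuous_birth hb
  have hdc := hφ.continuous_death hd
  have hbc' : Continuous fun t => b (φ (t - c * r)) :=
    hbc.comp (continuous_id.sub continuous_const)
  have hwc : Continuous fun t => φ t ^ m :=
    hφ.continuous.rpow_const fun _ => Or.inr (by linarith)
  obtain ⟨q, hq, hq'⟩ := exists_flux (c := c) (D := D) hφ.continuous hwc (hbc'.sub hdc)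
    fun ψ hψ => by
      have hI : ∀ {g : ℝ → ℝ}, Continuous g → Integrable fun t => g t * ψ t :=
        fun hg => (hg.mul hψ.1.continuous).integrable_of_hasCompactSupport hψ.2.mul_left
      have e : ∫ t, (b (φ (t - c * r)) - d (φ t)) * ψ t =
          (∫ t, b (φ (t - c * r)) * ψ t) - ∫ t, d (φ t) * ψ t := by
        rw [← integral_sub (hI hbc') (hI hdc)]
        congr 1; ext t; ring
      have := hφ.profileEq ψ hψ
      simp only [Pi.sub_apply]
      linarith
  exact ⟨q, hq, fun s t hs => flux_le (β₁ := fun t => b (φ t)) (δ₁ := fun t => d (φ t)) hq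
    (fun t => mul_nonneg hD.le (Real.rpow_nonneg (hφ.nonneg t) m)) hq' hφ.tendsto_atBot hbc hdc
    (hφ.tendsto_birth_atBot hb) fun x hx => hb.death_le hd (hφ.nonneg x) (hs x hx)⟩

/-- If the profile lies in `[x, y]` on `[s, t]`, having been below `κ` before, and the convection
and delay terms are bounded by `E` there, then `D φ^m` stays below a parabola on `[s, t]`. -/
theorem mul_rpow_le_parabola (hm : 1 < m) (hD : 0 < D) (hd : IsDeathRate d)
    (hb : IsUnimodalBirthRate b d κ) (hφ : IsSemiWavefront m D r c b d κ φ) {E β s t : ℝ}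
    (hst : s ≤ t) (hs : ∀ x ≤ s, φ x < κ)
    (hβ : ∀ x ∈ Icc s t, β ≤ b (φ x) - d (φ x))
    (hE : ∀ x ∈ Icc s t, c * φ x + (∫ z in (x - c * r)..x, b (φ z)) ≤ E) :
    D * φ t ^ m ≤ D * φ s ^ m + E * (t - s) - β * (t - s) ^ 2 / 2 := by
  obtain ⟨q, hq, hle⟩ := hφ.exists_flux_le hm hD hd hb
  refine le_parabola_of_deriv_le hst hq fun x hsx hxt => ?_
  have hint : β * (x - s) ≤ ∫ z in s..x, (b (φ z) - d (φ z)) := by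
    have h := intervalIntegral.integral_mono_on (μ := volume) hsx
      (intervalIntegrable_const (c := β))
      (((hφ.continuous_birth hb).sub (hφ.continuous_death hd)).intervalIntegrable s x)
      fun z hz => hβ z ⟨hz.1, hz.2.trans hxt⟩
    rw [intervalIntegral.integral_const, smul_eq_mul, mul_comm] at h
    exact h
  linarith [hle s x hs, hE x ⟨hsx, hxt⟩]

/-- A semi-wavefront reaches every level below the equilibrium. -/
theorem exists_le (hm : 1 < m) (hD : 0 < D) (hd : IsDeathRate d)
    (hb : IsUnimodalBirthRate b d κ) (hφ : IsSemiWavefront m D r c b d κ φ) {E y : ℝ}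
    (hy : y < κ)
    (hE : ∀ t, (∀ x ≤ t, φ x ≤ y) → c * φ t + (∫ z in (t - c * r)..t, b (φ z)) ≤ E) :
    ∃ t, y ≤ φ t := by
  by_contra! hcon
  -- A profile staying below `y` is eventually trapped in `[δ, y]`, where net production is at least
  -- `β > 0`; the parabola then forces `D φ^m` below zero.
  obtain ⟨δ, hδ, hδφ⟩ := exists_between hφ.liminf_pos
  obtain ⟨T, hT⟩ := eventually_atTop.1 (eventually_lt_of_lt_liminf hδφ
    (isBoundedUnder_of ⟨0, hφ.nonneg⟩))
  obtain ⟨β, hβ, hle⟩ := exists_pos_le_netProduction hd hb hδ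
    ((hT T le_rfl).trans (hcon T)).le hy
  set A := D * φ T ^ m
  have hA : 0 ≤ A := mul_nonneg hD.le (Real.rpow_nonneg (hφ.nonneg T) m)
  -- Chosen so that `β z ≥ 2 (|E| + 1)` and `z > A`, whence `A + E z - β z² / 2 ≤ A - z < 0`.
  set z := 2 * (|E| + 1) / β + A
  have hz : 0 ≤ z := by positivity
  have hpar := hφ.mul_rpow_le_parabola hm hD hd hb (E := E) (β := β) (s := T) (t := T + z)
    (by linarith) (fun x _ => (hcon x).trans hy)
    (fun x hx => hle _ ⟨(hT x hx.1).le, (hcon x).le⟩) fun x _ => hE x fun u _ => (hcon u).le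
  have h0 : 0 ≤ D * φ (T + z) ^ m := mul_nonneg hD.le (Real.rpow_nonneg (hφ.nonneg _) m)
  rw [add_sub_cancel_left] at hpar
  have hβz : 2 * (|E| + 1) ≤ β * z := by
    have : β * z = 2 * (|E| + 1) + β * A := by simp only [z]; field_simp
    nlinarith
  have h1 : 2 * (|E| + 1) * z ≤ β * z * z := mul_le_mul_of_nonneg_right hβz hz
  have h2 : E * z ≤ |E| * z := mul_le_mul_of_nonneg_right (le_abs_self E) hz
  have hzA : A < z := lt_add_of_pos_left _ (by positivity)
  nlinarith

/-- The rise of the profile from `x` to `y` is controlled by the bound `E` on the convection and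
delay terms and the lower bound `β` on the net production between these levels. -/
theorem mul_rpow_sub_le (hm : 1 < m) (hD : 0 < D) (hd : IsDeathRate d)
    (hb : IsUnimodalBirthRate b d κ) (hφ : IsSemiWavefront m D r c b d κ φ) {E β x y : ℝ}
    (hx : 0 < x) (hxy : x < y) (hy : y < κ) (hβ : 0 < β)
    (hβle : ∀ s ∈ Icc x y, β ≤ b s - d s)
    (hE : ∀ t, (∀ u ≤ t, φ u ≤ y) → c * φ t + (∫ z in (t - c * r)..t, b (φ z)) ≤ E) :
    D * (y ^ m - x ^ m) ≤ E ^ 2 / (2 * β) := by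
  obtain ⟨a, ha⟩ := eventually_atBot.1 (hφ.tendsto_atBot.eventually_lt_const hx)
  -- `t` is the first time at level `y`, and `s` below is the last time before `t` at level `x`, so
  -- `φ` stays in `[x, y]` on `[s, t]`.
  obtain ⟨t, ⟨hyt, hat⟩, htmin⟩ : ∃ t, IsLeast {t | y ≤ φ t ∧ a ≤ t} t := by
    obtain ⟨t, ht⟩ := hφ.exists_le hm hD hd hb hy hE
    have hbd : BddBelow {t | y ≤ φ t ∧ a ≤ t} := ⟨a, fun u hu => hu.2⟩
    refine ⟨_, IsClosed.isLeast_csInf ?_ ⟨t, ht, ?_⟩ hbd⟩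
    · exact (isClosed_le continuous_const hφ.continuous).inter isClosed_Ici
    · exact le_of_not_ge fun h => absurd (ha t h) (not_lt.2 (hxy.le.trans ht))
  have hbefore : ∀ u < t, φ u < y := fun u hu => by
    by_contra! h
    refine absurd (htmin ⟨h, ?_⟩) (not_le.2 hu)
    exact le_of_not_ge fun h' => absurd (ha u h') (not_lt.2 (hxy.le.trans h))
  have hty : φ t ≤ y := by
    refine le_of_tendsto (hφ.continuous.continuousAt.continuousWithinAt (s := Iio t)).tendsto ?_
    filter_upwards [self_mem_nhdsWithin] with u hu using (hbefore u hu).le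
  obtain ⟨s, ⟨hsx, hst⟩, hsmax⟩ : ∃ s, IsGreatest {s | φ s ≤ x ∧ s ≤ t} s :=
    ⟨_, IsClosed.isGreatest_csSup
      ((isClosed_le hφ.continuous continuous_const).inter isClosed_Iic)
      ⟨a, (ha a le_rfl).le, hat⟩ ⟨t, fun u hu => hu.2⟩⟩
  have hle : ∀ u ≤ t, φ u ≤ y := fun u hu => by
    rcases hu.eq_or_lt with rfl | h
    exacts [hty, (hbefore u h).le]
  have hst' : s < t := hst.lt_of_ne fun h => by subst h; linarith
  have hge : ∀ u ∈ Ioc s t, x < φ u := fun u hu => by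
    by_contra! h
    exact absurd (hsmax ⟨h, hu.2⟩) (not_le.2 hu.1)
  have hxs : x ≤ φ s := by
    refine ge_of_tendsto (hφ.continuous.continuousAt.continuousWithinAt (s := Ioi s)).tendsto ?_
    filter_upwards [Ioc_mem_nhdsGT hst'] with u hu using (hge u hu).le
  have hpar := hφ.mul_rpow_le_parabola hm hD hd hb (E := E) (β := β) hst
    (fun u hu => (hle u (hu.trans hst)).trans_lt hy)
    (fun u hu => hβle _ ⟨by
      rcases hu.1.eq_or_lt with rfl | h
      exacts [hxs, (hge u ⟨h, hu.2⟩).le], hle u hu.2⟩)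
    fun u hu => hE u fun v hv => hle v (hv.trans hu.2)
  rw [le_antisymm hty hyt, le_antisymm hsx hxs] at hpar
  rw [le_div_iff₀ (by positivity)]
  -- Completing the square: `E τ - β τ² / 2 ≤ E² / (2β)` with `τ = t - s`.
  nlinarith [sq_nonneg (E - β * (t - s))]

end IsSemiWavefront

/-! ### The speed threshold -/

/-- The convection and delay terms are bounded in terms of an upper bound `e / (r + 1)` on the
speed. -/
theorem convection_add_delay_le {e B y t : ℝ} (hr : 0 ≤ r) (he : 0 ≤ e) (hc : c * (r + 1) ≤ e)
    (hφ0 : 0 ≤ φ t) (hφ : φ t ≤ y) (hb0 : ∀ z, 0 ≤ b (φ z)) (hbB : ∀ z, b (φ z) ≤ B) :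
    c * φ t + (∫ z in (t - c * r)..t, b (φ z)) ≤ e * (y + B) := by
  have hB : 0 ≤ B := (hb0 0).trans (hbB 0)
  have hy : 0 ≤ y := hφ0.trans hφ
  rcases le_total c 0 with h | h
  · have hint : (∫ z in (t - c * r)..t, b (φ z)) ≤ 0 := by
      rw [intervalIntegral.integral_symm]
      exact neg_nonpos.2 (intervalIntegral.integral_nonneg
        (by nlinarith) fun z _ => hb0 z)
    have := mul_nonneg he (add_nonneg hy hB)
    nlinarith
  · have hint := intervalIntegral.norm_integral_le_of_norm_le_const (a := t - c * r) (b := t)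
      (f := fun z => b (φ z)) (C := B) fun z _ => by
        rw [Real.norm_of_nonneg (hb0 z)]; exact hbB z
    rw [sub_sub_cancel, abs_of_nonneg (mul_nonneg h hr)] at hint
    have h1 := (le_abs_self _).trans hint
    have h2 : c * φ t ≤ c * y := mul_le_mul_of_nonneg_left hφ h
    have h3 : c ≤ e := by nlinarith
    have h4 : c * r ≤ e := by nlinarith
    nlinarith [mul_le_mul_of_nonneg_right h3 hy, mul_le_mul_of_nonneg_right h4 hB]

end DelayWave

theorem theorem2p2 (m : ℝ) (hm : 1 < m) (b d : ℝ → ℝ) (κ : ℝ)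
    (hd : DelayWave.IsDeathRate d) (hb : DelayWave.IsUnimodalBirthRate b d κ) :
    ∃ (cdot : ℝ → ℝ) (μ₀ : ℝ),
      (∀ r, 0 ≤ r → 0 < cdot r) ∧
      (∀ D, 0 < D → ∀ r, 0 ≤ r → ∀ c, c < Real.sqrt D * cdot r →
        ¬ ∃ φ : ℝ → ℝ, DelayWave.IsSemiWavefront m D r c b d κ φ) ∧
      0 < μ₀ ∧
      (∃ ε : ℝ → ℝ, Tendsto ε atTop (𝓝 0) ∧
        ∀ r, 0 < r → cdot r = (μ₀ + ε r) / r) := by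
  have hκ := hb.equilibrium_pos
  obtain ⟨sM, hsM, -, hmax⟩ := hb.unimodal
  have hB : 0 ≤ b sM := hb.nonneg sM hsM.le
  -- Any two levels strictly between `0` and `κ` would serve.
  obtain ⟨β, hβ, hβle⟩ := DelayWave.exists_pos_le_netProduction hd hb
    (x := κ / 4) (y := κ / 2) (by linarith) (by linarith) (by linarith)
  set K := κ / 2 + b sM
  have hK : 0 < K := by positivity
  set J := (κ / 2) ^ m - (κ / 4) ^ m
  have hJ : 0 < J := sub_pos.2
    (Real.rpow_lt_rpow (by linarith) (by linarith) (by linarith))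
  -- With `E = √D μ K` this gives `E² / (2β) = D J / 2`, less than the required rise `D J`.
  set μ := Real.sqrt (β * J) / K with hμdef
  have hμ : 0 < μ := by positivity
  -- The shift `r + 1` bounds both `c` and `c r`, and keeps the threshold finite at `r = 0`; the
  -- error term comes from `r / (r + 1) = 1 - 1 / (r + 1)`.
  refine ⟨fun r => μ / (r + 1), μ, fun r hr => by positivity, ?_, hμ,
    fun r => -μ / (r + 1), ?_, fun r hr => by field_simp; ring⟩
  · rintro D hD r hr c hc ⟨φ, hφ⟩
    have hc' : c * (r + 1) ≤ Real.sqrt D * μ := by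
      rw [← mul_div_assoc, lt_div_iff₀ (by positivity)] at hc
      exact hc.le
    have h := hφ.mul_rpow_sub_le hm hD hd hb (E := Real.sqrt D * μ * K) (by linarith)
      (by linarith) (by linarith) hβ hβle fun t ht =>
        DelayWave.convection_add_delay_le hr (by positivity) hc' (hφ.nonneg t) (ht t le_rfl)
          (fun z => hb.nonneg _ (hφ.nonneg z)) fun z => hmax (hφ.nonneg z)
    have e : (Real.sqrt D * μ * K) ^ 2 = D * (β * J) := by
      rw [mul_assoc, hμdef, div_mul_cancel₀ _ hK.ne', mul_pow, Real.sq_sqrt hD.le,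
        Real.sq_sqrt (by positivity)]
    rw [e, le_div_iff₀ (by positivity)] at h
    nlinarith [mul_pos hD (mul_pos hβ hJ)]
  · exact tendsto_const_nhds.div_atTop (tendsto_atTop_add_const_right _ _ tendsto_id)
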